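/- Let $\mathbb{P}^\infty(\mathbb{Z}/2)$ be the set of sequences $z=(z_i)_{i\in\mathbb{N}}$ in $\mathbb{Z}/2$ with finitely many, and at least one, non-zero terms, ordered coordinatewise ($0\le 1$) and given the Alexandrov topology, whose open sets are the upper sets; put $\mathbb{A}_i=\{z : z_i=1\}$. A surjection $\alpha:\mathbb{N}\to\mathbb{N}$ is \emph{tame} if all its fibres are finite and only finitely many of them have more than one element; it induces a continuous map $\alpha^*:\mathbb{P}^\infty(\mathbb{Z}/2)\to\mathbb{P}^\infty(\mathbb{Z}/2)$, $\alpha^*(z)=z\circ\alpha$. Let $\widetilde{\mathrm{Sh}}_{\mathrm{fin}}$ be the following category. Its objects are the sheaves $P$ of commutative unital (complex) C*-algebras over $\mathbb{P}^\infty(\mathbb{Z}/2)$ (the zero algebra is allowed) that are flabby (all restriction homomorphisms are surjective) and finitely supported (there is $N\in\mathbb{N}$ with $P(\mathbb{A}_n)=0$ for all $n>N$). A morphism $P\to Q$ (an \emph{extended morphism}) is a pair $[f,\alpha^*]$ consisting of the map $\alpha^*$ for a tame surjection $\alpha$ and a morphism of sheaves of unital C*-algebras $f:(\alpha^*)_*P\to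 Q$ from the direct image; composition is $[g,\beta^*]\circ[f,\alpha^*]=[g\circ(\beta^*)_*f,\ \beta^*\circ\alpha^*]$. Two morphisms $[f,\alpha^*],[g,\beta^*]:P\to Q$ are equivalent, written $\sim$, if they agree on global sections, that is, if $f_{\mathbb{P}^\infty(\mathbb{Z}/2)}=g_{\mathbb{P}^\infty(\mathbb{Z}/2)}$ as homomorphisms $P(\mathbb{P}^\infty(\mathbb{Z}/2))\to Q(\mathbb{P}^\infty(\mathbb{Z}/2))$. Consider also the category of finite closed coverings of compact Hausdorff spaces. Its objects are pairs $(X,\mathcal{C})$ where $X$ is a compact Hausdorff space and $\mathcal{C}$ is a finite non-empty set of closed subsets of $X$ with $\bigcup\mathcal{C}=X$ (the empty subset may belong to $\mathcal{C}$, and $X$ may be empty). A morphism $(X,\mathcal{C})\to(X',\mathcal{C}')$ is a continuous map $f:X\to X'$ such that for every $C\in\mathcal{C}$ there is $C'\in\mathcal{C}'$ with $C\subseteq f^{-1}(C')$. Then the category of finite closed coverings of compact Hausdorff spaces is equivalent to the opposite of the quotient category $\widetilde{\mathrm{Sh}}_{\mathrm{fin}}/\!\sim$. -/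

import Mathlib

open CategoryTheory TopologicalSpace Opposite

universe u

namespace CoveringSheaf

/-! ### Finite closed coverings of compact Hausdorff spaces -/

/-- A compact Hausdorff space together with a finite closed covering: a finite non-empty set of
closed subsets whose union is the whole space. The empty subset is allowed as a member. -/
structure FinClosedCovering : Type (u + 1) where
  /-- The underlying compact Hausdorff space. -/
  space : CompHaus.{u}
  /-- The covering: a set (not a family) of subsets. -/
  cover : Set (Set space)
  finite : cover.Finite
  nonempty : cover.Nonempty
  isClosed : ∀ C ∈ cover, IsClosed C
  sUnion_eq : ⋃₀ cover = Set.univ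

namespace FinClosedCovering

/-- A morphism of coverings: a continuous map such that every member of the first covering is
contained in the preimage of some member of the second one. -/
@[ext]
structure Hom (X Y : FinClosedCovering.{u}) : Type u where
  /-- The underlying continuous map. -/
  map : X.space ⟶ Y.space
  subordinate : ∀ C ∈ X.cover, ∃ D ∈ Y.cover, C ⊆ map ⁻¹' D

instance : Category FinClosedCovering.{u} where
  Hom := Hom
  id X := ⟨𝟙 X.space, fun C hC => ⟨C, hC, fun _ hx => hx⟩⟩
  comp f g := ⟨f.map ≫ g.map, fun C hC => by
    obtain ⟨D, hD, hCD⟩ := f.subordinate C hC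
    obtain ⟨E, hE, hDE⟩ := g.subordinate D hD
    exact ⟨E, hE, fun x hx => hDE (hCD hx)⟩⟩

end FinClosedCovering

/-! ### Commutative unital C*-algebras -/

/-- Commutative unital (complex) C*-algebras. The zero algebra is allowed. -/
structure CommCStarAlg : Type (u + 1) where
  /-- The underlying type. -/
  carrier : Type u
  [str : CommCStarAlgebra carrier]

namespace CommCStarAlg

instance : CoeSort CommCStarAlg.{u} (Type u) := ⟨carrier⟩

instance (A : CommCStarAlg.{u}) : CommCStarAlgebra A := A.str

/-- Morphisms of commutative unital C*-algebras are the unital star-homomorphisms. -/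
@[ext]
structure Hom (A B : CommCStarAlg.{u}) : Type u where
  /-- The underlying unital star-homomorphism. -/
  hom : A →⋆ₐ[ℂ] B

instance : Category CommCStarAlg.{u} where
  Hom := Hom
  id A := ⟨StarAlgHom.id ℂ A⟩
  comp f g := ⟨g.hom.comp f.hom⟩

instance : ConcreteCategory CommCStarAlg.{u} (fun A B => A →⋆ₐ[ℂ] B) where
  hom f := f.hom
  ofHom f := ⟨f⟩

end CommCStarAlg

/-! ### The infinite projective space over `ℤ/2` -/

/-- The infinite projective space over `ℤ/2`: sequences in `ℤ/2` in which the number of non-zero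
terms is finite and greater than zero. -/
def PInf : Type :=
  {z : ℕ → ZMod 2 // {i | z i ≠ 0}.Finite ∧ {i | z i ≠ 0}.Nonempty}

namespace PInf

/-- The coordinatewise order, where `0 ≤ 1` in `ℤ/2`. -/
instance : PartialOrder PInf where
  le z w := ∀ i, (z.1 i).val ≤ (w.1 i).val
  le_refl _ _ := le_rfl
  le_trans _ _ _ h₁ h₂ i := (h₁ i).trans (h₂ i)
  le_antisymm _ _ h₁ h₂ :=
    Subtype.ext (funext fun i => ZMod.val_injective 2 (le_antisymm (h₁ i) (h₂ i)))

/-- The Alexandrov topology: the open sets are the upper sets. -/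
instance : TopologicalSpace PInf := Topology.upperSet PInf

/-- The basic open set of all points whose `i`-th coordinate is `1`. -/
def basicOpen (i : ℕ) : Opens PInf where
  carrier := {z | z.1 i = 1}
  is_open' := by
    intro z w hzw hz
    have hz' : z.1 i = 1 := hz
    have h : (z.1 i).val ≤ (w.1 i).val := hzw i
    have key : ∀ a b : ZMod 2, a = 1 → a.val ≤ b.val → b = 1 := by decide
    exact key _ _ hz' h

end PInf

/-- The infinite projective space as an object of the category of topological spaces. -/
abbrev PInfTop : TopCat.{0} := TopCat.of PInf

/-- A tame surjection of `ℕ`: all fibres are finite and only finitely many of them have more than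
one element. -/
structure IsTame (α : ℕ → ℕ) : Prop where
  surjective : Function.Surjective α
  finite_fiber : ∀ i, (α ⁻¹' {i}).Finite
  finite_multiple : {i | 1 < (α ⁻¹' {i}).ncard}.Finite

/-- A continuous self-map of the infinite projective space is a tame pullback if it is
`z ↦ z ∘ α` for some tame surjection `α`; on characteristic functions this is
`χ_a ↦ χ_{α⁻¹(a)}`. -/
def IsTamePullback (φ : PInfTop ⟶ PInfTop) : Prop :=
  ∃ α : ℕ → ℕ, IsTame α ∧ ∀ (z : PInf) (i : ℕ), (φ z : PInf).1 i = z.1 (α i)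

theorem IsTame.id : IsTame (fun i : ℕ => i) where
  surjective i := ⟨i, rfl⟩
  finite_fiber i := Set.finite_singleton i
  finite_multiple := by
    convert Set.finite_empty (α := ℕ) using 1
    ext i
    simp

theorem IsTame.comp {α β : ℕ → ℕ} (hα : IsTame α) (hβ : IsTame β) :
    IsTame (fun i => α (β i)) where
  surjective := hα.surjective.comp hβ.surjective
  finite_fiber i := by
    have h : (fun j => α (β j)) ⁻¹' {i} = β ⁻¹' (α ⁻¹' {i}) := rfl
    rw [h]
    exact (hα.finite_fiber i).preimage' fun b _ => hβ.finite_fiber b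
  finite_multiple := by
    refine (hα.finite_multiple.union (hβ.finite_multiple.image α)).subset ?_
    intro i hi
    by_contra hcon
    simp only [Set.mem_union, Set.mem_ofPred_eq, Set.mem_image, not_or, not_exists, not_and,
      not_lt] at hcon
    obtain ⟨h₁, h₂⟩ := hcon
    have hi' : 1 < ((fun j => α (β j)) ⁻¹' {i}).ncard := hi
    obtain ⟨x, y, hx, hy, hxy⟩ := (Set.one_lt_ncard_iff (by
      have h : (fun j => α (β j)) ⁻¹' {i} = β ⁻¹' (α ⁻¹' {i}) := rfl
      rw [h]
      exact (hα.finite_fiber i).preimage' fun b _ => hβ.finite_fiber b)).1 hi'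
    have hx' : α (β x) = i := hx
    have hy' : α (β y) = i := hy
    have hβxy : β x = β y :=
      (Set.ncard_le_one (hα.finite_fiber i)).1 h₁ _ hx' _ hy'
    have hle : (β ⁻¹' {β x}).ncard ≤ 1 := by
      by_contra hlt
      exact h₂ (β x) (not_le.1 hlt) hx'
    exact hxy ((Set.ncard_le_one (hβ.finite_fiber (β x))).1 hle x rfl y hβxy.symm)

theorem IsTamePullback.id : IsTamePullback (𝟙 PInfTop) :=
  ⟨_, IsTame.id, fun _ _ => rfl⟩

theorem IsTamePullback.comp {φ ψ : PInfTop ⟶ PInfTop} (hφ : IsTamePullback φ)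
    (hψ : IsTamePullback ψ) : IsTamePullback (φ ≫ ψ) := by
  obtain ⟨α, hα, h₁⟩ := hφ
  obtain ⟨β, hβ, h₂⟩ := hψ
  exact ⟨_, hα.comp hβ, fun z i => (h₂ (φ z) i).trans (h₁ z (β i))⟩

/-! ### Finitely supported flabby sheaves with extended morphisms -/

/-- A finitely supported flabby sheaf of commutative unital C*-algebras over the infinite
projective space. -/
structure FlabbySheaf : Type (u + 1) where
  /-- The underlying presheaf. -/
  presheaf : TopCat.Presheaf CommCStarAlg.{u} PInfTop
  /-- Compatible families of sections over an open cover have a unique gluing. -/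
  isSheaf : presheaf.IsSheafUniqueGluing
  /-- All restriction homomorphisms are surjective. -/
  flabby : ∀ ⦃U V : Opens PInfTop⦄ (h : V ⟶ U), Function.Surjective (presheaf.map h.op)
  /-- The sections over all but finitely many of the basic open sets form the zero algebra. -/
  finite_support : ∃ N : ℕ, ∀ n, N < n → Subsingleton (presheaf.obj (op (PInf.basicOpen n)))

namespace FlabbySheaf

/-- An extended morphism `P ⟶ Q`: a tame pullback `φ` together with a morphism of sheaves from
the direct image `φ_* P` to `Q`. -/
structure ExtHom (P Q : FlabbySheaf.{u}) : Type u where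
  /-- The continuous self-map of the infinite projective space. -/
  base : PInfTop ⟶ PInfTop
  tame : IsTamePullback base
  /-- The morphism of sheaves. -/
  hom : (TopCat.Presheaf.pushforward CommCStarAlg.{u} base).obj P.presheaf ⟶ Q.presheaf

/-- Extended morphisms, with composition
`[g, ψ] ∘ [f, φ] = [g ∘ ψ_* f, ψ ∘ φ]` (recall that `ψ_* φ_* = (ψ ∘ φ)_*`). -/
instance : Category FlabbySheaf.{u} where
  Hom := ExtHom
  id P := ⟨𝟙 PInfTop, IsTamePullback.id, (TopCat.Presheaf.Pushforward.id P.presheaf).hom⟩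
  comp {P _ _} f g := ⟨f.base ≫ g.base, f.tame.comp g.tame,
    (TopCat.Presheaf.Pushforward.comp f.base g.base P.presheaf).hom ≫
      (TopCat.Presheaf.pushforward CommCStarAlg.{u} g.base).map f.hom ≫ g.hom⟩

/-- The homomorphism induced by an extended morphism on global sections; the global sections of
a direct image `φ_* P` are those of `P`, since the preimage of the whole space is the whole
space. -/
def globalMap {P Q : FlabbySheaf.{u}} (f : P ⟶ Q) :
    P.presheaf.obj (op ⊤) ⟶ Q.presheaf.obj (op ⊤) :=
  f.hom.app (op ⊤)

/-- Two extended morphisms are equivalent if they agree on global sections. -/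
def rel : HomRel FlabbySheaf.{u} := fun _ _ f g => globalMap f = globalMap g

/-- The quotient of the category of finitely supported flabby sheaves with extended morphisms by
the above relation. -/
abbrev QuotientCategory : Type (u + 1) := CategoryTheory.Quotient rel.{u}

end FlabbySheaf

end CoveringSheaf

/-!
The equivalence is Gelfand duality with coverings kept on the side. A sheaf `P` is sent to the
spectrum of its algebra of global sections `P(⊤)`, covered by the zero loci of the ideals
`ker (P(⊤) → P(𝔸ᵢ))`; all but finitely many zero loci are empty, and they cover because the `𝔸ᵢ`
cover the projective space and characters are multiplicative (`FlabbySheaf.iUnion_zeroLocus`).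
This is a contravariant functor (`FlabbySheaf.spectrumFunctor`). Two extended morphisms have the
same image exactly if they agree on global sections (`FlabbySheaf.rel_eq_homRel`), so it remains to
see that the functor is full and essentially surjective.

*Fullness.* A continuous map of spectra is dual to a homomorphism `φ : P(⊤) → Q(⊤)`. Subordination
provides, for each `i` in the support of `Q`, an index `α i` such that `φ` maps sections vanishing
on `𝔸_{α i}` to sections vanishing on `𝔸ᵢ`; outside the support any value of `α` will do, and a
shift makes `α` a tame surjection. Gluing and flabbiness show that a section vanishing on `U ⊓ V` is
a sum of one vanishing on `U` and one vanishing on `V` (`FlabbySheaf.vanishingIdeal_inf_le`). Since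
each point has a minimal neighbourhood that is a finite intersection of sets `𝔸ᵢ`, `φ` respects the
vanishing ideals of all open sets. As all sections extend globally, `φ` then induces a morphism of
sheaves (`FlabbySheaf.exists_globalMap_eq`).

*Essential surjectivity.* Enumerate a finite closed covering of `X` by `ℕ`, padded by the empty
set, and let `X → ℙ^∞(ℤ/2)` record the members containing a point. Preimages `X_U` of open sets are
closed, and `U ↦ C(X_U, ℂ)` is a sheaf by gluing along finite closed coverings, and flabby by
Tietze's theorem (`IndexedCovering.sheaf`). The spectrum of `C(X, ℂ)` is `X`, and Urysohn's lemma
recovers the members of the covering (`IndexedCovering.homeoSpectrum_mem_zeroLocus`).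
-/

namespace CoveringSheaf

open WeakDual

/-! ### Ideals of global sections vanishing on an open set -/

namespace FlabbySheaf

variable (P : FlabbySheaf.{u})

/-- Restriction of sections of `P` along an inclusion of open sets, as a star homomorphism. -/
def res {U V : Opens PInfTop} (h : V ≤ U) :
    P.presheaf.obj (op U) →⋆ₐ[ℂ] P.presheaf.obj (op V) :=
  (P.presheaf.map (homOfLE h).op).hom

theorem res_surjective {U V : Opens PInfTop} (h : V ≤ U) : Function.Surjective (P.res h) :=
  P.flabby (homOfLE h)

theorem res_self {U : Opens PInfTop} (h : U ≤ U) (a : P.presheaf.obj (op U)) :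
    P.res h a = a := by
  have : P.presheaf.map (homOfLE h).op = 𝟙 _ := P.presheaf.map_id (op U)
  unfold res
  rw [this]
  rfl

theorem res_res {U V W : Opens PInfTop} (h : V ≤ U) (h' : W ≤ V)
    (a : P.presheaf.obj (op U)) : P.res h' (P.res h a) = P.res (h'.trans h) a := by
  have : P.presheaf.map (homOfLE (h'.trans h)).op =
      P.presheaf.map (homOfLE h).op ≫ P.presheaf.map (homOfLE h').op := by
    rw [← P.presheaf.map_comp]
    rfl
  unfold res
  rw [this]
  rfl

/-- The ideal of global sections that vanish on the open set `U`. -/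
def vanishingIdeal (U : Opens PInfTop) : Ideal (P.presheaf.obj (op ⊤)) :=
  RingHom.ker (P.res (le_top : U ≤ ⊤))

variable {P} in
theorem mem_vanishingIdeal {U : Opens PInfTop} {a : P.presheaf.obj (op ⊤)} :
    a ∈ P.vanishingIdeal U ↔ P.res (le_top : U ≤ ⊤) a = 0 :=
  Iff.rfl

theorem vanishingIdeal_anti {U V : Opens PInfTop} (h : V ≤ U) :
    P.vanishingIdeal U ≤ P.vanishingIdeal V := fun a ha => by
  rw [mem_vanishingIdeal] at ha ⊢
  rw [← P.res_res le_top h, ha, map_zero]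

theorem eq_zero_of_mem_vanishingIdeal_top {a : P.presheaf.obj (op ⊤)}
    (ha : a ∈ P.vanishingIdeal ⊤) : a = 0 := by
  rwa [mem_vanishingIdeal, res_self] at ha

variable {P} in
theorem mem_vanishingIdeal_iSup {ι : Type} (U : ι → Opens PInfTop)
    {a : P.presheaf.obj (op ⊤)} (ha : ∀ i, a ∈ P.vanishingIdeal (U i)) :
    a ∈ P.vanishingIdeal (iSup U) := by
  obtain ⟨s, -, hs⟩ := P.isSheaf U (fun i => (0 : P.presheaf.obj (op (U i)))) fun i j => by
    exact (map_zero (P.res inf_le_left)).trans (map_zero (P.res inf_le_right)).symm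
  refine (hs (P.res le_top a) fun i => ?_).trans (hs 0 fun i => ?_).symm
  · exact (P.res_res le_top (le_iSup U i) a).trans (ha i)
  · exact map_zero (P.res (le_iSup U i))

/-- A global section `a` vanishing on `U ⊓ V` is the sum of one vanishing on `U` and one vanishing
on `V`: glue `a` on `U` with `0` on `V`, and extend the result to a global section. -/
theorem vanishingIdeal_inf_le (U V : Opens PInfTop) :
    P.vanishingIdeal (U ⊓ V) ≤ P.vanishingIdeal U ⊔ P.vanishingIdeal V := by
  intro a ha
  let W : Bool → Opens PInfTop := fun b => cond b U V
  let sf : ∀ b, P.presheaf.obj (op (W b)) := fun b =>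
    Bool.rec (motive := fun b => P.presheaf.obj (op (W b))) (0 : P.presheaf.obj (op V))
      (P.res (le_top : U ≤ ⊤) a) b
  obtain ⟨s, hs, -⟩ := P.isSheaf W sf (by
    have hUV : P.res (inf_le_left : U ⊓ V ≤ U) (P.res le_top a) =
        P.res (inf_le_right : U ⊓ V ≤ V) 0 := by
      rw [res_res, map_zero]; exact ha
    have hVU : P.res (inf_le_left : V ⊓ U ≤ V) 0 =
        P.res (inf_le_right : V ⊓ U ≤ U) (P.res le_top a) := by
      rw [res_res, map_zero]
      exact (P.vanishingIdeal_anti (le_of_eq (inf_comm V U)) ha).symm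
    rintro (_ | _) (_ | _)
    · rfl
    · exact hVU
    · exact hUV
    · rfl)
  obtain ⟨b, rfl⟩ := P.res_surjective (le_top : iSup W ≤ ⊤) s
  have hU : P.res (le_top : U ≤ ⊤) b = P.res le_top a :=
    (P.res_res le_top (le_iSup W true) b).symm.trans (hs true)
  have hV : P.res (le_top : V ≤ ⊤) b = 0 :=
    (P.res_res le_top (le_iSup W false) b).symm.trans (hs false)
  refine Submodule.mem_sup.2 ⟨a - b, ?_, b, hV, sub_add_cancel a b⟩
  rw [mem_vanishingIdeal, map_sub, hU, sub_self]

/-- Iteration of `vanishingIdeal_inf_le`. For empty `s` this says that a section vanishing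
everywhere is zero. -/
theorem vanishingIdeal_finset_inf_le (s : Finset ℕ) (U : ℕ → Opens PInfTop) :
    P.vanishingIdeal (s.inf U) ≤ ⨆ i ∈ s, P.vanishingIdeal (U i) := by
  classical
  induction s using Finset.induction with
  | empty =>
    intro a ha
    rw [P.eq_zero_of_mem_vanishingIdeal_top ha]
    exact zero_mem _
  | insert i s _ ih =>
    rw [Finset.inf_insert, Finset.iSup_insert]
    exact (P.vanishingIdeal_inf_le _ _).trans (sup_le_sup le_rfl ih)

end FlabbySheaf

/-! ### Minimal open neighbourhoods in the projective space -/

/-- The support of a point of the projective space. -/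
noncomputable def PInf.support (z : PInf) : Finset ℕ := z.2.1.toFinset

theorem PInf.mem_support {z : PInf} {i : ℕ} : i ∈ z.support ↔ z.1 i = 1 := by
  have key : ∀ a : ZMod 2, a ≠ 0 ↔ a = 1 := by decide
  simpa [PInf.support] using key (z.1 i)

theorem PInf.mem_finset_inf {s : Finset ℕ} {U : ℕ → Opens PInf} {z : PInf} :
    z ∈ s.inf U ↔ ∀ i ∈ s, z ∈ U i := by
  classical
  induction s using Finset.induction with
  | empty => simp
  | insert i s _ ih => rw [Finset.inf_insert, Finset.forall_mem_insert, ← ih]; rfl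

theorem PInf.isOpen_iff {U : Set PInf} : IsOpen U ↔ IsUpperSet U := Iff.rfl

theorem PInf.le_of_support {z w : PInf} (h : ∀ i, z.1 i = 1 → w.1 i = 1) : z ≤ w := fun i => by
  have key : ∀ a b : ZMod 2, (a = 1 → b = 1) → a.val ≤ b.val := by decide
  exact key _ _ (h i)

/-- The smallest open neighbourhood of `z` is the intersection of the basic open sets
containing `z`. -/
theorem PInf.inf_basicOpen_le {U : Opens PInf} {z : PInf} (hz : z ∈ U) :
    z.support.inf basicOpen ≤ U := fun _ hw =>
  PInf.isOpen_iff.1 U.2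
    (PInf.le_of_support fun i hi => PInf.mem_finset_inf.1 hw i (PInf.mem_support.2 hi)) hz

/-! ### Extended morphisms from homomorphisms of global sections -/

/-- A star homomorphism out of the target of a surjective one, induced by a homomorphism that
vanishes on the kernel. -/
noncomputable def starLift {A B C : Type*} [CommCStarAlgebra A] [CommCStarAlgebra B]
    [CommCStarAlgebra C] (p : A →⋆ₐ[ℂ] B) (hp : Function.Surjective p) (q : A →⋆ₐ[ℂ] C)
    (h : ∀ a, p a = 0 → q a = 0) : B →⋆ₐ[ℂ] C :=
  have key : ∀ a a', p a = p a' → q a = q a' := fun a a' haa => by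
    rw [← sub_eq_zero, ← map_sub]
    exact h _ (by rw [map_sub, haa, sub_self])
  have hinv : ∀ a, q (Function.surjInv hp (p a)) = q a := fun a =>
    key _ _ (Function.surjInv_eq hp _)
  { toFun := fun b => q (Function.surjInv hp b)
    map_one' := by rw [← map_one p, hinv, map_one]
    map_zero' := by rw [← map_zero p, hinv, map_zero]
    map_mul' := hp.forall₂.2 fun a a' => by rw [← map_mul, hinv, hinv, hinv, map_mul]
    map_add' := hp.forall₂.2 fun a a' => by rw [← map_add, hinv, hinv, hinv, map_add]
    commutes' := fun r => by rw [← AlgHomClass.commutes p, hinv, AlgHomClass.commutes]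
    map_star' := hp.forall.2 fun a => by rw [← map_star, hinv, hinv, map_star] }

theorem starLift_apply {A B C : Type*} [CommCStarAlgebra A] [CommCStarAlgebra B]
    [CommCStarAlgebra C] (p : A →⋆ₐ[ℂ] B) (hp : Function.Surjective p) (q : A →⋆ₐ[ℂ] C)
    (h : ∀ a, p a = 0 → q a = 0) (a : A) : starLift p hp q h (p a) = q a := by
  rw [← sub_eq_zero]
  change q (Function.surjInv hp (p a)) - q a = 0
  rw [← map_sub]
  exact h _ (by rw [map_sub, sub_eq_zero]; exact Function.surjInv_eq hp _)

namespace FlabbySheaf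

variable {P Q : FlabbySheaf.{u}}

/-- It suffices to compare vanishing ideals on the basic open sets. By separation, vanishing on `U`
can be tested on the minimal neighbourhood of each point of `U`; that neighbourhood is a finite
intersection of basic open sets, so its vanishing ideal is the sum of theirs. -/
theorem vanishingIdeal_le_comap {φ : P.presheaf.obj (op ⊤) →⋆ₐ[ℂ] Q.presheaf.obj (op ⊤)}
    {base : PInfTop ⟶ PInfTop} {α : ℕ → ℕ}
    (hα : ∀ (z : PInf) (i : ℕ), (base z : PInf).1 i = z.1 (α i))
    (hφ : ∀ i, P.vanishingIdeal (PInf.basicOpen (α i)) ≤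
      (Q.vanishingIdeal (PInf.basicOpen i)).comap φ) (U : Opens PInfTop) :
    P.vanishingIdeal ((Opens.map base).obj U) ≤ (Q.vanishingIdeal U).comap φ := by
  have hU : U = ⨆ z : U, (z : PInf).support.inf PInf.basicOpen := by
    refine le_antisymm (fun z hz => ?_) (iSup_le fun z => PInf.inf_basicOpen_le z.2)
    exact Opens.mem_iSup.2 ⟨⟨z, hz⟩, PInf.mem_finset_inf.2 fun i hi => PInf.mem_support.1 hi⟩
  intro a ha
  rw [Ideal.mem_comap, hU]
  refine mem_vanishingIdeal_iSup (fun z : U => (z : PInf).support.inf PInf.basicOpen) fun z => ?_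
  rw [← Ideal.mem_comap]
  have hle : (z : PInf).support.inf (fun i => PInf.basicOpen (α i)) ≤ (Opens.map base).obj U := by
    intro w hw
    refine PInf.inf_basicOpen_le z.2 (PInf.mem_finset_inf.2 fun i hi => ?_)
    exact (hα w i).trans (PInf.mem_finset_inf.1 hw i hi)
  refine (((P.vanishingIdeal_anti hle).trans (P.vanishingIdeal_finset_inf_le _ _)).trans
    (iSup₂_le fun i hi => ?_)) ha
  exact (hφ i).trans (Ideal.comap_mono (Q.vanishingIdeal_anti (Finset.inf_le hi)))

/-- A homomorphism between the algebras of global sections that respects the vanishing ideals of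
the basic open sets, up to a tame reindexing, is induced by an extended morphism. -/
theorem exists_globalMap_eq (φ : P.presheaf.obj (op ⊤) →⋆ₐ[ℂ] Q.presheaf.obj (op ⊤))
    {base : PInfTop ⟶ PInfTop} {α : ℕ → ℕ} (tame : IsTame α)
    (hα : ∀ (z : PInf) (i : ℕ), (base z : PInf).1 i = z.1 (α i))
    (hφ : ∀ i, P.vanishingIdeal (PInf.basicOpen (α i)) ≤
      (Q.vanishingIdeal (PInf.basicOpen i)).comap φ) :
    ∃ f : P ⟶ Q, (globalMap f).hom = φ := by
  have hker := vanishingIdeal_le_comap hα hφ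
  -- Sections over any open set extend globally by flabbiness, so `φ` determines every component.
  let F (U : Opens PInfTop) :
      P.presheaf.obj (op ((Opens.map base).obj U)) →⋆ₐ[ℂ] Q.presheaf.obj (op U) :=
    starLift (P.res le_top) (P.res_surjective le_top) ((Q.res le_top).comp φ)
      fun a ha => hker U ha
  have hF (U) (a) : F U (P.res le_top a) = Q.res le_top (φ a) := starLift_apply ..
  let f : P ⟶ Q := ⟨base, ⟨α, tame, hα⟩,
    { app := fun U => ⟨F U.unop⟩
      naturality := fun U V g => by
        refine CommCStarAlg.Hom.ext (StarAlgHom.ext fun b => ?_)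
        obtain ⟨a, rfl⟩ := P.res_surjective le_top b
        have hVU : V.unop ≤ U.unop := leOfHom g.unop
        have h₁ : F V.unop (P.res ((Opens.map base).map g.unop).le (P.res le_top a)) =
            Q.res hVU (F U.unop (P.res le_top a)) := by
          rw [res_res, hF, hF, res_res]
        exact h₁ }⟩
  refine ⟨f, StarAlgHom.ext fun a => ?_⟩
  have h := hF ⊤ a
  have h' : F ⊤ a = φ a := by
    rw [res_self] at h
    rw [← h]
    congr 1
    exact (P.res_self _ a).symm
  exact h'

end FlabbySheaf

/-! ### The covering of the spectrum of the global sections -/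

namespace FlabbySheaf

variable (P Q : FlabbySheaf.{u})

/-- The `i`-th member of the covering of the spectrum of the algebra of global sections: the
characters that vanish on all sections vanishing on `PInf.basicOpen i`. -/
def zeroLocus (i : ℕ) : Set (characterSpace ℂ (P.presheaf.obj (op ⊤))) :=
  {χ | ∀ a ∈ P.vanishingIdeal (PInf.basicOpen i), χ a = 0}

theorem isClosed_zeroLocus (i : ℕ) : IsClosed (P.zeroLocus i) := by
  have h : P.zeroLocus i = ⋂ a ∈ P.vanishingIdeal (PInf.basicOpen i),
      {χ : characterSpace ℂ (P.presheaf.obj (op ⊤)) | gelfandTransform ℂ _ a χ = 0} := by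
    ext χ
    simp [zeroLocus]
  rw [h]
  exact isClosed_biInter fun a _ => isClosed_eq (map_continuous _) continuous_const

theorem one_mem_vanishingIdeal {U : Opens PInfTop} (h : Subsingleton (P.presheaf.obj (op U))) :
    1 ∈ P.vanishingIdeal U :=
  h.elim _ _

theorem zeroLocus_eq_empty {i : ℕ}
    (h : Subsingleton (P.presheaf.obj (op (PInf.basicOpen i)))) : P.zeroLocus i = ∅ := by
  refine Set.eq_empty_of_forall_notMem fun χ hχ => ?_
  have := hχ 1 (P.one_mem_vanishingIdeal h)
  rw [map_one] at this
  exact one_ne_zero this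

theorem finite_range_zeroLocus : (Set.range P.zeroLocus).Finite := by
  obtain ⟨N, hN⟩ := P.finite_support
  refine (((Set.finite_Iic N).image P.zeroLocus).insert ∅).subset ?_
  rintro _ ⟨i, rfl⟩
  rcases le_or_gt i N with hi | hi
  · exact Or.inr ⟨i, hi, rfl⟩
  · exact Or.inl (P.zeroLocus_eq_empty (hN i hi))

theorem iSup_basicOpen : ⨆ i, PInf.basicOpen i = (⊤ : Opens PInfTop) := by
  refine eq_top_iff.2 fun z _ => ?_
  obtain ⟨i, hi⟩ := z.2.2
  exact Opens.mem_iSup.2 ⟨i, PInf.mem_support.1 (z.2.1.mem_toFinset.2 hi)⟩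

/-- Characters are prime, and the product of the finitely many relevant vanishing ideals is zero
because the basic open sets cover the projective space. -/
theorem iUnion_zeroLocus : ⋃ i, P.zeroLocus i = Set.univ := by
  refine Set.eq_univ_of_forall fun χ => ?_
  by_contra hχ
  simp only [zeroLocus, Set.mem_iUnion, Set.mem_ofPred_eq, not_exists, not_forall] at hχ
  choose a ha hχa using hχ
  obtain ⟨N, hN⟩ := P.finite_support
  have h0 : ∏ i ∈ Finset.range (N + 1), a i = 0 := by
    refine P.eq_zero_of_mem_vanishingIdeal_top ?_
    refine P.vanishingIdeal_anti iSup_basicOpen.ge (mem_vanishingIdeal_iSup _ fun i => ?_)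
    rcases le_or_gt i N with hi | hi
    · exact Ideal.prod_mem _ (Finset.mem_range_succ_iff.2 hi) (ha i)
    · have := hN i hi
      exact Subsingleton.elim _ _
  have h1 := congrArg χ h0
  rw [map_prod, map_zero, Finset.prod_eq_zero_iff] at h1
  obtain ⟨i, -, hi⟩ := h1
  exact hχa i hi

/-- The spectrum of the algebra of global sections with the covering by the zero loci of the
vanishing ideals of the basic open sets. -/
noncomputable def spectrumCovering : FinClosedCovering.{u} where
  space := CompHaus.of (characterSpace ℂ (P.presheaf.obj (op ⊤)))
  cover := Set.range P.zeroLocus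
  finite := P.finite_range_zeroLocus
  nonempty := Set.range_nonempty _
  isClosed := by
    rintro _ ⟨i, rfl⟩
    exact P.isClosed_zeroLocus i
  sUnion_eq := by
    rw [Set.sUnion_range]
    exact P.iUnion_zeroLocus

variable {P Q}

/-- For a base map induced by `α`, the component of `f` over `PInf.basicOpen i` is defined on the
sections over `PInf.basicOpen (α i)`. -/
theorem map_mem_vanishingIdeal (f : P ⟶ Q) {α : ℕ → ℕ}
    (hα : ∀ (z : PInf) (i : ℕ), (f.base z : PInf).1 i = z.1 (α i)) (i : ℕ)
    {a : P.presheaf.obj (op ⊤)} (ha : a ∈ P.vanishingIdeal (PInf.basicOpen (α i))) :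
    (globalMap f).hom a ∈ Q.vanishingIdeal (PInf.basicOpen i) := by
  have hle : (Opens.map f.base).obj (PInf.basicOpen i) ≤ PInf.basicOpen (α i) :=
    fun z hz => (hα z i).symm.trans hz
  have ha' := P.vanishingIdeal_anti hle ha
  have hnat := congrArg CommCStarAlg.Hom.hom
    (f.hom.naturality (homOfLE (le_top : PInf.basicOpen i ≤ ⊤)).op)
  have h := DFunLike.congr_fun hnat a
  have h' : (f.hom.app (op (PInf.basicOpen i))).hom (P.res le_top a) =
      Q.res le_top ((globalMap f).hom a) := h
  rw [mem_vanishingIdeal] at ha' ⊢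
  rw [← h', ha', map_zero]

/-- The morphism of coverings of spectra induced by an extended morphism. -/
noncomputable def spectrumMap (f : P ⟶ Q) : Q.spectrumCovering ⟶ P.spectrumCovering where
  map := CompHausLike.ofHom _ (CharacterSpace.compContinuousMap (globalMap f).hom)
  subordinate := by
    rintro _ ⟨i, rfl⟩
    obtain ⟨α, -, hα⟩ := f.tame
    exact ⟨_, ⟨α i, rfl⟩, fun χ hχ a ha => hχ _ (map_mem_vanishingIdeal f hα i ha)⟩

theorem globalMap_comp {R : FlabbySheaf.{u}} (f : P ⟶ Q) (g : Q ⟶ R) :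
    globalMap (f ≫ g) = globalMap f ≫ globalMap g :=
  CommCStarAlg.Hom.ext (StarAlgHom.ext fun _ => rfl)

theorem globalMap_id : globalMap (𝟙 P) = 𝟙 _ := 
  CommCStarAlg.Hom.ext (StarAlgHom.ext fun _ => rfl)

/-- The contravariant functor from sheaves with extended morphisms to coverings. -/
noncomputable def spectrumFunctor : FlabbySheaf.{u} ⥤ FinClosedCovering.{u}ᵒᵖ where
  obj P := op P.spectrumCovering
  map f := (spectrumMap f).op
  map_id P := by
    refine Quiver.Hom.unop_inj (FinClosedCovering.Hom.ext ?_)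
    simp only [Quiver.Hom.unop_op, spectrumMap, globalMap_id]
    rfl
  map_comp f g := by
    refine Quiver.Hom.unop_inj (FinClosedCovering.Hom.ext ?_)
    simp only [Quiver.Hom.unop_op, spectrumMap, globalMap_comp]
    rfl

/-! ### The spectrum functor is full, and faithful up to the relation -/

theorem ext_of_forall_character {A : Type*} [CommCStarAlgebra A] {a b : A}
    (h : ∀ χ : characterSpace ℂ A, χ a = χ b) : a = b :=
  (gelfandTransform_bijective A).1 (ContinuousMap.ext h)

/-- Characters separate elements, so a homomorphism is determined by the map of spectra. -/
theorem rel_eq_homRel : rel.{u} = spectrumFunctor.{u}.homRel := by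
  funext P Q f g
  refine propext ⟨fun h => ?_, fun h => ?_⟩
  · refine Quiver.Hom.unop_inj (FinClosedCovering.Hom.ext ?_)
    have h' : globalMap f = globalMap g := h
    change CompHausLike.ofHom _ _ = CompHausLike.ofHom _ _
    rw [h']
  · refine CommCStarAlg.Hom.ext (StarAlgHom.ext fun a => ext_of_forall_character fun χ => ?_)
    have h' : (spectrumMap f).map = (spectrumMap g).map :=
      congrArg (fun k => FinClosedCovering.Hom.map (Quiver.Hom.unop k)) h
    have h'' := DFunLike.congr_fun (congrArg (fun k => ConcreteCategory.hom k) h') χ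
    exact DFunLike.congr_fun (congrArg Subtype.val h'') a

/-- Gelfand duality: continuous maps of spectra come from homomorphisms. -/
theorem exists_comp_eq {A B : Type*} [CommCStarAlgebra A] [CommCStarAlgebra B]
    (h : C(characterSpace ℂ B, characterSpace ℂ A)) :
    ∃ φ : A →⋆ₐ[ℂ] B, ∀ χ a, h χ a = χ (φ a) := by
  refine ⟨((gelfandStarTransform B).symm : _ →⋆ₐ[ℂ] B).comp
    ((h.compStarAlgHom' ℂ ℂ).comp (gelfandStarTransform A : A →⋆ₐ[ℂ] _)), fun χ a => ?_⟩
  have := DFunLike.congr_fun ((gelfandStarTransform B).apply_symm_apply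
    ((gelfandStarTransform A a).comp h)) χ
  exact this.symm

/-- The characters in `P.zeroLocus i` include the restrictions of all characters of
`P(PInf.basicOpen i)`, and the latter separate elements. -/
theorem mem_vanishingIdeal_of_forall {i : ℕ} {a : P.presheaf.obj (op ⊤)}
    (h : ∀ χ ∈ P.zeroLocus i, χ a = 0) : a ∈ P.vanishingIdeal (PInf.basicOpen i) := by
  rw [mem_vanishingIdeal]
  refine ext_of_forall_character fun χ => ?_
  rw [map_zero]
  refine h (CharacterSpace.compContinuousMap (P.res le_top) χ) fun b hb => ?_
  change χ (P.res le_top b) = 0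
  rw [mem_vanishingIdeal.1 hb, map_zero]

/-- Any function can be changed beyond a given index so as to become a tame surjection. -/
theorem exists_isTame (β : ℕ → ℕ) (N : ℕ) : ∃ α, IsTame α ∧ ∀ i ≤ N, α i = β i := by
  let α : ℕ → ℕ := fun i => if i ≤ N then β i else i - (N + 1)
  have hfib (j) : α ⁻¹' {j} ⊆ insert (j + (N + 1)) (Set.Iic N) := by
    intro i (hi : (if i ≤ N then β i else i - (N + 1)) = j)
    split_ifs at hi with h
    · exact Or.inr h
    · left; omega
  have hfin (j) : (α ⁻¹' {j}).Finite := ((Set.finite_Iic N).insert _).subset (hfib j)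
  refine ⟨α, ⟨fun j => ⟨j + (N + 1), ?_⟩, hfin, ?_⟩, fun i hi => if_pos hi⟩
  · simp only [α]
    rw [if_neg (by omega)]
    omega
  · refine ((Set.finite_Iic N).image α).subset fun j hj => ?_
    obtain ⟨x, y, hx, hy, hxy⟩ := (Set.one_lt_ncard_iff (hfin j)).1 hj
    rcases hfib j hx with h | h
    · rcases hfib j hy with h' | h'
      · exact (hxy (h.trans h'.symm)).elim
      · exact ⟨y, h', hy⟩
    · exact ⟨x, h, hx⟩

/-- The pullback of points along a tame surjection. -/
def tamePullback {α : ℕ → ℕ} (hα : IsTame α) : PInfTop ⟶ PInfTop :=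
  TopCat.ofHom
    { toFun := fun z => (⟨fun i => z.1 (α i),
        z.2.1.preimage' fun i _ => hα.finite_fiber i, z.2.2.preimage hα.surjective⟩ : PInf)
      continuous_toFun := ⟨fun _ hU => PInf.isOpen_iff.2 fun _ _ hzw hz =>
        PInf.isOpen_iff.1 hU (fun i => hzw (α i)) hz⟩ }

instance : spectrumFunctor.{u}.Full where
  map_surjective {P Q} k := by
    let h : Q.spectrumCovering ⟶ P.spectrumCovering := k.unop
    obtain ⟨φ, hφ⟩ := exists_comp_eq (A := P.presheaf.obj (op ⊤)) (B := Q.presheaf.obj (op ⊤))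
      (ConcreteCategory.hom h.map)
    obtain ⟨N, hN⟩ := Q.finite_support
    have hsub (i) : ∃ j, Q.zeroLocus i ⊆ h.map ⁻¹' P.zeroLocus j := by
      obtain ⟨_, ⟨j, rfl⟩, hj⟩ := h.subordinate _ ⟨i, rfl⟩
      exact ⟨j, hj⟩
    choose β hβ using hsub
    obtain ⟨α, tame, hα⟩ := exists_isTame β N
    obtain ⟨f, hf⟩ := exists_globalMap_eq φ (base := tamePullback tame) tame (fun _ _ => rfl) (by
      intro i a ha
      -- Beyond the support of `Q` the values of `α` do not matter.
      rcases le_or_gt i N with hi | hi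
      · rw [hα i hi] at ha
        refine mem_vanishingIdeal_of_forall fun χ hχ => ?_
        rw [← hφ]
        exact hβ i hχ a ha
      · have := hN i hi
        exact Subsingleton.elim _ _)
    refine ⟨f, Quiver.Hom.unop_inj (FinClosedCovering.Hom.ext ?_)⟩
    refine ConcreteCategory.hom_ext _ _ fun χ => ?_
    refine Subtype.ext (ContinuousLinearMap.ext fun a => ?_)
    refine Eq.trans ?_ (hφ χ a).symm
    rw [← hf]
    rfl

end FlabbySheaf

/-! ### The sheaf of functions on a covering -/

/-- A closed covering of a compact Hausdorff space indexed by `ℕ`, with all but finitely many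
members empty. -/
structure IndexedCovering (X : Type u) [TopologicalSpace X] where
  /-- The members of the covering. -/
  member : ℕ → Set X
  isClosed : ∀ i, IsClosed (member i)
  iUnion_eq : ⋃ i, member i = Set.univ
  eventually_empty : ∃ N, ∀ i, N < i → member i = ∅

namespace IndexedCovering

variable {X : Type u} [TopologicalSpace X] (K : IndexedCovering X)

open Classical in
/-- The classifying map of the covering: the `i`-th coordinate of the image of `x` is `1` exactly
if `x` lies in the `i`-th member. -/
noncomputable def classify (x : X) : PInf :=
  ⟨fun i => if x ∈ K.member i then 1 else 0, by
    obtain ⟨N, hN⟩ := K.eventually_empty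
    refine (Set.finite_Iic N).subset fun i hi => ?_
    by_contra h
    have := hN i (not_le.1 h)
    simp [this] at hi, by
    obtain ⟨i, hi⟩ := Set.mem_iUnion.1 (K.iUnion_eq.ge (Set.mem_univ x))
    exact ⟨i, by simp [hi]⟩⟩

theorem classify_eq_one {x : X} {i : ℕ} : (K.classify x).1 i = 1 ↔ x ∈ K.member i := by
  by_cases h : x ∈ K.member i <;> simp [classify, h]

theorem le_classify {x : X} {z : PInf} :
    z ≤ K.classify x ↔ ∀ i ∈ z.support, x ∈ K.member i := by
  refine ⟨fun h i hi => ?_, fun h => PInf.le_of_support fun i hi => ?_⟩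
  · have := PInf.isOpen_iff.1 (PInf.basicOpen i).2 h (PInf.mem_support.1 hi)
    exact K.classify_eq_one.1 this
  · exact K.classify_eq_one.2 (h i (PInf.mem_support.2 hi))

theorem finite_range_classify : (Set.range K.classify).Finite := by
  obtain ⟨N, hN⟩ := K.eventually_empty
  refine Set.Finite.of_injOn (f := PInf.support) (t := (Finset.range (N + 1)).powerset)
    ?_ ?_ (Finset.finite_toSet _)
  · rintro _ ⟨x, rfl⟩
    refine Finset.mem_coe.2 (Finset.mem_powerset.2 fun i hi => ?_)
    rw [PInf.mem_support, classify_eq_one] at hi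
    rw [Finset.mem_range_succ_iff]
    by_contra h
    rw [hN i (not_le.1 h)] at hi
    exact hi
  · intro z _ w _ h
    refine le_antisymm ?_ ?_ <;>
      exact PInf.le_of_support fun i hi => PInf.mem_support.1 (by
        exact h ▸ PInf.mem_support.2 hi)

/-- The closed subset of `X` over an open subset of the projective space. -/
def region (U : Opens PInf) : Set X := K.classify ⁻¹' U

theorem region_mono {U V : Opens PInf} (h : V ≤ U) : K.region V ⊆ K.region U :=
  Set.preimage_mono h

/-- Although `K.classify` is not continuous, preimages of open sets are closed: they are finite
unions of finite intersections of members of the covering. -/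
theorem isClosed_region (U : Opens PInf) : IsClosed (K.region U) := by
  have h : K.region U = ⋃ z ∈ Set.range K.classify ∩ U, ⋂ i ∈ z.support, K.member i := by
    ext x
    simp only [Set.mem_iUnion, Set.mem_iInter, exists_prop]
    refine ⟨fun hx => ⟨K.classify x, ⟨⟨x, rfl⟩, hx⟩, K.le_classify.1 le_rfl⟩, ?_⟩
    rintro ⟨z, ⟨-, hz⟩, hx⟩
    exact PInf.isOpen_iff.1 U.2 (K.le_classify.2 hx) hz
  rw [h]
  exact (K.finite_range_classify.inter_of_left _).isClosed_biUnion fun z _ =>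
    isClosed_biInter fun i _ => K.isClosed i

variable [CompactSpace X]

instance (U : Opens PInf) : CompactSpace (K.region U) :=
  isCompact_iff_compactSpace.1 (K.isClosed_region U).isCompact

/-- The presheaf of continuous complex functions on the closed sets `K.region U`. -/
noncomputable def presheaf : TopCat.Presheaf CommCStarAlg.{u} PInfTop where
  obj U := ⟨C(K.region U.unop, ℂ)⟩
  map g := ⟨(ContinuousMap.inclusion (K.region_mono (leOfHom g.unop))).compStarAlgHom' ℂ ℂ⟩

theorem isSheaf_presheaf : K.presheaf.IsSheafUniqueGluing := by
  intro ι U sf hsf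
  let s (i : ι) : C(K.region (U i), ℂ) := sf i
  have hs (i j : ι) (x : X) (hi : x ∈ K.region (U i)) (hj : x ∈ K.region (U j)) :
      s i ⟨x, hi⟩ = s j ⟨x, hj⟩ := by
    have h : x ∈ K.region (U i ⊓ U j) := ⟨hi, hj⟩
    exact ContinuousMap.congr_fun
      (show (s i).comp (ContinuousMap.inclusion (K.region_mono inf_le_left)) =
        (s j).comp (ContinuousMap.inclusion (K.region_mono inf_le_right)) from hsf i j) ⟨x, h⟩
  have hex (z : PInf) (hz : z ∈ iSup U) : ∃ i, z ∈ U i := Opens.mem_iSup.1 hz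
  choose k hk using hex
  let g (x : K.region (iSup U)) : ℂ := s (k _ x.2) ⟨x, hk _ x.2⟩
  have hg (x : K.region (iSup U)) (i : ι) (hi : x.1 ∈ K.region (U i)) : g x = s i ⟨x, hi⟩ :=
    hs _ _ _ _ _
  let R := Set.range fun x : K.region (iSup U) => K.classify x
  have hR : R ⊆ (iSup U : Opens PInfTop) := by
    rintro _ ⟨x, rfl⟩
    exact x.2
  have : Finite R := (K.finite_range_classify.subset (by
    rintro _ ⟨x, rfl⟩
    exact ⟨x, rfl⟩)).to_subtype
  have hcont : Continuous g := by
    -- Finitely many of the open sets suffice, as `K.classify` has finite range.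
    refine (locallyFinite_of_finite fun w : R => {x : K.region (iSup U) |
      x.1 ∈ K.region (U (k w (hR w.2)))}).continuous ?_ ?_ ?_
    · refine Set.eq_univ_of_forall fun x => Set.mem_iUnion.2 ⟨⟨_, x, rfl⟩, ?_⟩
      exact hk _ _
    · exact fun w => (K.isClosed_region _).preimage continuous_subtype_val
    · intro w
      rw [continuousOn_iff_continuous_domRestrict]
      let e : {x : K.region (iSup U) | x.1 ∈ K.region (U (k w (hR w.2)))} →
          K.region (U (k w (hR w.2))) := fun x => ⟨x.1.1, x.2⟩
      have he : Continuous e :=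
        (continuous_subtype_val.comp continuous_subtype_val).subtype_mk _
      exact ((s _).continuous.comp he).congr fun x => (hg x.1 _ x.2).symm
  refine ⟨(⟨g, hcont⟩ : C(K.region (iSup U), ℂ)), fun i => ?_, fun t ht => ?_⟩
  · exact ContinuousMap.ext fun x => hg ⟨x, _⟩ i x.2
  · let t' : C(K.region (iSup U), ℂ) := t
    refine ContinuousMap.ext (f := t') fun x => ?_
    have h := ht (k _ x.2)
    exact ContinuousMap.congr_fun (show t'.comp
      (ContinuousMap.inclusion (K.region_mono (le_iSup U _))) = s (k _ x.2) from h) ⟨x, hk _ x.2⟩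

variable [T2Space X]

/-- The flabby sheaf of continuous complex functions on the closed sets `K.region U`; it is flabby
by the Tietze extension theorem. -/
noncomputable def sheaf : FlabbySheaf.{u} where
  presheaf := K.presheaf
  isSheaf := K.isSheaf_presheaf
  flabby U V h f := by
    let f' : C(K.region V, ℂ) := f
    have hVU : K.region V ⊆ K.region U := K.region_mono (leOfHom h)
    let e := ContinuousMap.inclusion hVU
    have he : Topology.IsClosedEmbedding e :=
      e.continuous.isClosedEmbedding (Set.inclusion_injective hVU)
    obtain ⟨g, hg⟩ := f'.exists_extension he
    exact ⟨g, hg⟩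
  finite_support := by
    obtain ⟨N, hN⟩ := K.eventually_empty
    refine ⟨N, fun n hn => ?_⟩
    have : IsEmpty (K.region (PInf.basicOpen n)) := by
      refine ⟨fun x => ?_⟩
      have := K.classify_eq_one.1 x.2
      rw [hN n hn] at this
      exact this
    exact ⟨fun f g => ContinuousMap.ext (f := (f : C(K.region (PInf.basicOpen n), ℂ)))
      (g := (g : C(K.region (PInf.basicOpen n), ℂ))) fun x => this.elim x⟩

/-! ### The spectrum of the sheaf of functions -/

/-- The space `X` as the closed set over the whole projective space. -/
def homeoRegionTop : X ≃ₜ K.region ⊤ := (Homeomorph.Set.univ X).symm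

/-- Points of `X` are the characters of the algebra of global sections. -/
noncomputable def homeoSpectrum :
    X ≃ₜ characterSpace ℂ (K.sheaf.presheaf.obj (op ⊤)) :=
  K.homeoRegionTop.trans (CharacterSpace.homeoEval (K.region ⊤) ℂ)

theorem homeoSpectrum_mem_zeroLocus {x : X} {i : ℕ} :
    K.homeoSpectrum x ∈ K.sheaf.zeroLocus i ↔ x ∈ K.member i := by
  refine ⟨fun h => ?_, fun hx f hf => ?_⟩
  · by_contra hx
    obtain ⟨f, hf0, hf1, -⟩ := exists_continuous_zero_one_of_isClosed (K.isClosed i)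
      (isClosed_singleton (x := x)) (Set.disjoint_singleton_right.2 hx)
    let F : C(K.region ⊤, ℂ) := ⟨fun y => (f y : ℂ), by fun_prop⟩
    have hF : F ∈ K.sheaf.vanishingIdeal (PInf.basicOpen i) := by
      refine ContinuousMap.ext (f := (K.sheaf.res le_top F :
        C(K.region (PInf.basicOpen i), ℂ))) fun y => ?_
      exact congrArg Complex.ofReal (hf0 (K.classify_eq_one.1 y.2))
    have h1 : F ⟨x, trivial⟩ = 0 := h F hF
    have h2 : F ⟨x, trivial⟩ = 1 := congrArg Complex.ofReal (hf1 rfl)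
    exact one_ne_zero (h2.symm.trans h1)
  · exact ContinuousMap.congr_fun (FlabbySheaf.mem_vanishingIdeal.1 hf :
      (K.sheaf.res le_top f : C(K.region (PInf.basicOpen i), ℂ)) = 0)
      ⟨x, K.classify_eq_one.2 hx⟩

end IndexedCovering

/-! ### Essential surjectivity and the equivalence -/

namespace FinClosedCovering

/-- A finite covering can be enumerated by `ℕ` with the empty set as padding. -/
theorem exists_indexedCovering (X : FinClosedCovering.{u}) :
    ∃ K : IndexedCovering X.space, (∀ i, K.member i = ∅ ∨ K.member i ∈ X.cover) ∧
      ∀ C ∈ X.cover, ∃ i, K.member i = C := by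
  obtain ⟨n, c, hc⟩ := X.finite.fin_param
  let m : ℕ → Set X.space := fun i => if h : i < n then c ⟨i, h⟩ else ∅
  have h₁ (i) : m i = ∅ ∨ m i ∈ X.cover := by
    by_cases h : i < n
    · right
      simp only [m, dif_pos h]
      exact hc.2 ▸ ⟨_, rfl⟩
    · exact Or.inl (dif_neg h)
  have h₂ : ∀ C ∈ X.cover, ∃ i, m i = C := by
    intro C hC
    rw [← hc.2] at hC
    obtain ⟨i, rfl⟩ := hC
    exact ⟨i, dif_pos i.2⟩
  refine ⟨⟨m, fun i => ?_, ?_, n, fun i hi => dif_neg (by omega)⟩, h₁, h₂⟩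
  · rcases h₁ i with h | h
    · rw [h]; exact isClosed_empty
    · exact X.isClosed _ h
  · refine Set.eq_univ_of_forall fun x => ?_
    obtain ⟨C, hC, hx⟩ := X.sUnion_eq.ge (Set.mem_univ x)
    obtain ⟨i, rfl⟩ := h₂ C hC
    exact Set.mem_iUnion.2 ⟨i, hx⟩

end FinClosedCovering

instance : FlabbySheaf.spectrumFunctor.{u}.EssSurj where
  mem_essImage Y := by
    obtain ⟨X, rfl⟩ := Opposite.op_surjective Y
    obtain ⟨K, h₁, h₂⟩ := X.exists_indexedCovering
    let f : X ⟶ K.sheaf.spectrumCovering :=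
      { map := CompHausLike.ofHom _ (K.homeoSpectrum : C(_, _))
        subordinate := fun C hC => by
          obtain ⟨i, rfl⟩ := h₂ C hC
          exact ⟨_, ⟨i, rfl⟩, fun x hx => K.homeoSpectrum_mem_zeroLocus.2 hx⟩ }
    let g : K.sheaf.spectrumCovering ⟶ X :=
      { map := CompHausLike.ofHom _ (K.homeoSpectrum.symm : C(_, _))
        subordinate := by
          rintro _ ⟨i, rfl⟩
          have hi : K.sheaf.zeroLocus i ⊆ K.homeoSpectrum.symm ⁻¹' K.member i := fun χ hχ => by
            rw [Set.mem_preimage, ← K.homeoSpectrum_mem_zeroLocus,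
              Homeomorph.apply_symm_apply]
            exact hχ
          rcases h₁ i with h | h
          -- The padding by `∅` is harmless, as `∅` lies in any member of the covering.
          · obtain ⟨C, hC⟩ := X.nonempty
            rw [h, Set.preimage_empty] at hi
            exact ⟨C, hC, hi.trans (Set.empty_subset _)⟩
          · exact ⟨_, h, hi⟩ }
    let e : X ≅ K.sheaf.spectrumCovering :=
      { hom := f
        inv := g
        hom_inv_id := FinClosedCovering.Hom.ext
          (ConcreteCategory.hom_ext _ _ fun x => K.homeoSpectrum.symm_apply_apply x)
        inv_hom_id := FinClosedCovering.Hom.ext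
          (ConcreteCategory.hom_ext _ _ fun x => K.homeoSpectrum.apply_symm_apply x) }
    exact ⟨K.sheaf, ⟨e.op⟩⟩

end CoveringSheaf

theorem corollary2 :
    Nonempty (CoveringSheaf.FinClosedCovering.{u} ≌
      (CoveringSheaf.FlabbySheaf.QuotientCategory.{u})ᵒᵖ) := by
  unfold CoveringSheaf.FlabbySheaf.QuotientCategory
  rw [CoveringSheaf.FlabbySheaf.rel_eq_homRel]
  exact ⟨(CategoryTheory.Quotient.lift CoveringSheaf.FlabbySheaf.spectrumFunctor.{u}.homRel
    CoveringSheaf.FlabbySheaf.spectrumFunctor.{u}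
    (fun _ _ _ _ h => h)).asEquivalence.leftOp.symm⟩
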